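/- Let $\mathbb{B}$ be the open unit ball of the quaternions $\mathbb{H}$, let $\mathrm{Sp}(1)=\{u\in\mathbb{H}:|u|=1\}$ and let $\mathrm{Sp}(1,1)=\{A\in M_2(\mathbb{H}) : A^*I_{1,1}A=I_{1,1}\}$, where $I_{1,1}=\mathrm{diag}(1,-1)$, with its structure of embedded submanifold of $M_2(\mathbb{H})$. For functions on $\mathbb{B}$ with expansions $f(q)=\sum_n q^na_n$, $g(q)=\sum_n q^nb_n$ (slice regular functions) put $(f*g)(q)=\sum_n q^n\sum_{k=0}^n a_kb_{n-k}$, $f^c(q)=\sum_n q^n\overline{a_n}$, $f^s=f*f^c$ and $f^{-*}=(f^s)^{-1}f^c$ (where $f^s\neq 0$). For $A=\begin{pmatrix}a&c\\b&d\end{pmatrix}\in\mathrm{Sp}(1,1)$ the regular M\"obius transformation $\mathcal{F}_A:\mathbb{B}\to\mathbb{B}$ is $\mathcal{F}_A=(qc+d)^{-*}*(qa+b)$. Let $\mathcal{M}(\mathbb{B})=\{\mathcal{F}_A : A\in\mathrm{Sp}(1,1)\}$ and $\mathcal{M}(\mathbb{B})_0=\{\mathcal{F}\in\mathcal{M}(\mathbb{B}):\mathcal{F}(0)=0\}$.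 Then $\mathcal{M}(\mathbb{B})$ has a smooth ($7$-dimensional) manifold structure for which the map $\mathrm{Sp}(1,1)\to\mathcal{M}(\mathbb{B})$, $A\mapsto\mathcal{F}_{A^{-1}}$, is a submersion, i.e. a surjective smooth map whose differential is surjective at every point (this property determines the structure); and $\mathcal{M}(\mathbb{B})_0$ is an embedded submanifold of $\mathcal{M}(\mathbb{B})$ which, with the composition of maps, is a Lie group. For these structures the map $$\mathcal{M}(\mathbb{B})_0\times\mathcal{M}(\mathbb{B})\to\mathcal{M}(\mathbb{B}),\qquad(\mathcal{F}_0,\mathcal{F})\mapsto\mathcal{F}_0\circ\mathcal{F},$$ is well defined and is a smooth action of the Lie group $\mathcal{M}(\mathbb{B})_0$ on the manifold $\mathcal{M}(\mathbb{B})$. This action is free (if $\mathcal{F}_0\circ\mathcal{F}=\mathcal{F}$ for some $\mathcal{F}$, then $\mathcal{F}_0$ is the identity) and proper (for every compact $K\subset\mathcal{M}(\mathbb{B})$ the set $\{\mathcal{F}_0\in\mathcal{M}(\mathbb{B})_0 : \mathcal{F}_0K\cap K\neq\emptyset\}$ is compact). -/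

import Mathlib

open scoped Quaternion Manifold ContDiff Matrix

noncomputable section

namespace SliceMobius

/-- `ℍ` has real dimension `3 + 1`, so that Mathlib makes its unit sphere a smooth `3`-manifold. -/
instance finrank_quaternion_fact : Fact (Module.finrank ℝ ℍ[ℝ] = 3 + 1) :=
  ⟨Quaternion.finrank_eq_four⟩

/-- The open unit ball `𝔹` of the quaternions (an open submanifold of `ℍ`). -/
def Ball : TopologicalSpace.Opens ℍ[ℝ] := ⟨Metric.ball 0 1, Metric.isOpen_ball⟩

/-- `Sp(1)`, the unit quaternions; group and smooth structures on the sphere are Mathlib's. -/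
abbrev Sp1 : Type := Metric.sphere (0 : ℍ[ℝ]) 1

/-- `2 × 2` matrices with quaternionic entries. -/
abbrev Mat2 : Type := Matrix (Fin 2) (Fin 2) ℍ[ℝ]

/-- The matrix `I_{1,1} = diag(1, -1)`. -/
def I11 : Mat2 := !![1, 0; 0, -1]

theorem I11_mul_I11 : I11 * I11 = 1 := by
  refine Matrix.ext fun i j => ?_; fin_cases i <;> fin_cases j <;> simp [I11, Matrix.mul_apply]

theorem I11_conjTranspose : I11ᴴ = I11 := by
  refine Matrix.ext fun i j => ?_; fin_cases i <;> fin_cases j <;> simp [I11]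

/-- `Sp(1,1) = {A ∈ M₂(ℍ) : A* I_{1,1} A = I_{1,1}}`. It carries the subspace topology. -/
def Sp11 : Submonoid Mat2 where
  carrier := {A | Aᴴ * I11 * A = I11}
  mul_mem' := by
    intro A B hA hB
    change Aᴴ * I11 * A = I11 at hA
    change Bᴴ * I11 * B = I11 at hB
    change (A * B)ᴴ * I11 * (A * B) = I11
    calc (A * B)ᴴ * I11 * (A * B) = Bᴴ * (Aᴴ * I11 * A) * B := by
          rw [Matrix.conjTranspose_mul]; simp only [Matrix.mul_assoc]
      _ = I11 := by rw [hA, hB]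
  one_mem' := by simp

theorem Sp11.inv_mul (A : Sp11) : (I11 * (A : Mat2)ᴴ * I11) * A = 1 := by
  have h : (A : Mat2)ᴴ * I11 * A = I11 := A.2
  calc (I11 * (A : Mat2)ᴴ * I11) * A = I11 * ((A : Mat2)ᴴ * I11 * A) := by
        simp only [Matrix.mul_assoc]
    _ = 1 := by rw [h, I11_mul_I11]

theorem Sp11.mul_inv (A : Sp11) : (A : Mat2) * (I11 * (A : Mat2)ᴴ * I11) = 1 :=
  mul_eq_one_comm.mp (Sp11.inv_mul A)

/-- `Sp(1,1)` is a group under matrix multiplication, with `A⁻¹ = I_{1,1} A* I_{1,1}`. -/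
instance : Group Sp11 where
  inv A := ⟨I11 * (A : Mat2)ᴴ * I11, by
    change (I11 * (A : Mat2)ᴴ * I11)ᴴ * I11 * (I11 * (A : Mat2)ᴴ * I11) = I11
    simp only [Matrix.conjTranspose_mul, Matrix.conjTranspose_conjTranspose, I11_conjTranspose]
    calc I11 * ((A : Mat2) * I11) * I11 * (I11 * (A : Mat2)ᴴ * I11)
        = I11 * (A : Mat2) * (I11 * I11) * (I11 * (A : Mat2)ᴴ * I11) := by
          simp only [Matrix.mul_assoc]
      _ = I11 * ((A : Mat2) * (I11 * (A : Mat2)ᴴ * I11)) := by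
          rw [I11_mul_I11]; simp only [Matrix.mul_assoc, Matrix.one_mul]
      _ = I11 := by rw [Sp11.mul_inv A, Matrix.mul_one]⟩
  inv_mul_cancel A := Subtype.ext (Sp11.inv_mul A)

theorem Sp11.inv_apply (A : Sp11) : A⁻¹.1 0 0 = star (A.1 0 0) ∧ A⁻¹.1 0 1 = -star (A.1 1 0) ∧
    A⁻¹.1 1 0 = -star (A.1 0 1) ∧ A⁻¹.1 1 1 = star (A.1 1 1) := by
  have h : ∀ i j, A⁻¹.1 i j = (I11 * (A : Mat2)ᴴ * I11) i j := fun _ _ => rfl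
  have e00 : I11 0 0 = 1 := rfl
  have e01 : I11 0 1 = 0 := rfl
  have e10 : I11 1 0 = 0 := rfl
  have e11 : I11 1 1 = -1 := rfl
  refine ⟨?_, ?_, ?_, ?_⟩ <;> rw [h] <;>
    simp only [Matrix.mul_apply, Fin.sum_univ_two, Matrix.conjTranspose_apply, e00, e01, e10, e11] <;>
    simp

theorem Sp11.col_rel (A : Sp11) : 
    star (A.1 0 0) * A.1 0 0 - star (A.1 1 0) * A.1 1 0 = 1 ∧
    star (A.1 0 0) * A.1 0 1 = star (A.1 1 0) * A.1 1 1 ∧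
    star (A.1 1 1) * A.1 1 1 - star (A.1 0 1) * A.1 0 1 = 1 := by
  have h : (A : Mat2)ᴴ * I11 * A = I11 := A.2
  have h00 := congrFun (congrFun h 0) 0
  have h01 := congrFun (congrFun h 0) 1
  have h11 := congrFun (congrFun h 1) 1
  simp [Matrix.mul_apply, I11] at h00 h01 h11
  refine ⟨by rw [← h00]; abel, ?_, ?_⟩
  · rw [← sub_eq_zero, ← h01]; abel
  · rw [← neg_inj, ← h11]; abel

theorem Sp11.row_rel (A : Sp11) : 
    A.1 0 0 * star (A.1 0 0) - A.1 0 1 * star (A.1 0 1) = 1 ∧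
    A.1 0 0 * star (A.1 1 0) = A.1 0 1 * star (A.1 1 1) ∧
    A.1 1 1 * star (A.1 1 1) - A.1 1 0 * star (A.1 1 0) = 1 := by
  have h : (A : Mat2) * I11 * (A : Mat2)ᴴ = I11 := by
    have h' := congrArg (· * I11) (Sp11.mul_inv A)
    simpa [Matrix.mul_assoc, I11_mul_I11] using h'
  have h00 := congrFun (congrFun h 0) 0
  have h01 := congrFun (congrFun h 0) 1
  have h11 := congrFun (congrFun h 1) 1
  simp [Matrix.mul_apply, I11] at h00 h01 h11
  refine ⟨by rw [← h00]; abel, ?_, ?_⟩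
  · rw [← sub_eq_zero, ← h01]; abel
  · rw [← neg_inj, ← h11]; abel

theorem Sp11.norm_rel (A : Sp11) : ‖A.1 0 0‖ ^ 2 - ‖A.1 1 0‖ ^ 2 = 1 ∧
    ‖A.1 1 1‖ ^ 2 - ‖A.1 0 1‖ ^ 2 = 1 ∧ ‖A.1 0 0‖ ^ 2 - ‖A.1 0 1‖ ^ 2 = 1 ∧
    ‖A.1 1 1‖ ^ 2 - ‖A.1 1 0‖ ^ 2 = 1 := by
  obtain ⟨h1, -, h2⟩ := Sp11.col_rel A
  obtain ⟨h3, -, h4⟩ := Sp11.row_rel A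
  simp only [Quaternion.star_mul_self, Quaternion.self_mul_star, Quaternion.normSq_eq_norm_mul_self] at h1 h2 h3 h4
  have h1 := congrArg QuaternionAlgebra.re h1
  have h2 := congrArg QuaternionAlgebra.re h2
  have h3 := congrArg QuaternionAlgebra.re h3
  have h4 := congrArg QuaternionAlgebra.re h4
  simp at h1 h2 h3 h4
  refine ⟨?_, ?_, ?_, ?_⟩ <;> linarith

/-! ### Slice regular functions on the ball and their operations -/

/-- `f(q) = ∑ qⁿ aₙ` on `𝔹`. The functions that have such an expansion (with coefficients on the
right) are exactly the slice regular functions on `𝔹`. -/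
def HasSliceExpansion (f : Ball → ℍ[ℝ]) (a : ℕ → ℍ[ℝ]) : Prop :=
  ∀ q : Ball, HasSum (fun n => (q : ℍ[ℝ]) ^ n * a n) (f q)

open Classical in
/-- The coefficients of the power series of a slice regular function (they are unique, see
`HasSliceExpansion.unique`); the value `0` is a placeholder for the other functions. -/
def coeffs (f : Ball → ℍ[ℝ]) : ℕ → ℍ[ℝ] :=
  if h : ∃ a, HasSliceExpansion f a then h.choose else 0

/-- The regular product `f * g = ∑ qⁿ cₙ`, `cₙ = ∑_{k ≤ n} a_k b_{n-k}`. -/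
def starMul (f g : Ball → ℍ[ℝ]) : Ball → ℍ[ℝ] := fun q =>
  ∑' n, (q : ℍ[ℝ]) ^ n * ∑ k ∈ Finset.range (n + 1), coeffs f k * coeffs g (n - k)

/-- The regular conjugate `fᶜ = ∑ qⁿ (conjugate of aₙ)`. -/
def regConj (f : Ball → ℍ[ℝ]) : Ball → ℍ[ℝ] := fun q =>
  ∑' n, (q : ℍ[ℝ]) ^ n * star (coeffs f n)

/-- The symmetrization `fˢ = f * fᶜ`. -/
def symmetrization (f : Ball → ℍ[ℝ]) : Ball → ℍ[ℝ] := starMul f (regConj f)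

/-- The regular reciprocal `f^{-*} = (1 / fˢ) fᶜ`. -/
def starInv (f : Ball → ℍ[ℝ]) : Ball → ℍ[ℝ] := fun q =>
  (symmetrization f q)⁻¹ * regConj f q

/-- `l_{(a,b)}(q) = q a + b`. -/
def linFun (a b : ℍ[ℝ]) : Ball → ℍ[ℝ] := fun q => (q : ℍ[ℝ]) * a + b

/-- The regular Möbius transformation `𝓕_A = l_{(c,d)}^{-*} * l_{(a,b)}` for the matrix `A` with
rows `(a, c)` and `(b, d)`, as a function with values in `ℍ`. -/
def mobiusFun (A : Sp11) : Ball → ℍ[ℝ] :=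
  starMul (starInv (linFun (A.1 0 1) (A.1 1 1))) (linFun (A.1 0 0) (A.1 1 0))

/-! ### `𝓕_A` maps the ball to itself -/

theorem Ball.mem_iff {x : ℍ[ℝ]} : x ∈ Ball ↔ ‖x‖ < 1 := by
  change x ∈ Metric.ball (0 : ℍ[ℝ]) 1 ↔ _
  simp

theorem Ball.norm_lt (q : Ball) : ‖(q : ℍ[ℝ])‖ < 1 := by
  exact Ball.mem_iff.1 q.2

theorem HasSliceExpansion.unique {f : Ball → ℍ[ℝ]} {a b : ℕ → ℍ[ℝ]}
    (ha : HasSliceExpansion f a) (hb : HasSliceExpansion f b) : a = b := by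
  have key : ∀ c : ℕ → ℍ[ℝ], HasSliceExpansion f c → 
      HasFPowerSeriesAt (fun t : ℝ => if h : |t| < 1 then f ⟨(t : ℍ[ℝ]), Ball.mem_iff.2 (by simpa using h)⟩ else 0)
        (show FormalMultilinearSeries ℝ ℝ ℍ[ℝ] from
          fun n => ContinuousMultilinearMap.mkPiRing ℝ (Fin n) (c n)) 0 := by
    intro c hc
    refine hasFPowerSeriesAt_iff.2 ?_
    filter_upwards [Metric.ball_mem_nhds (0 : ℝ) one_pos] with t ht
    have ht' : |t| < 1 := by simpa using ht
    rw [zero_add, dif_pos ht']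
    have e : (fun n => t ^ n • FormalMultilinearSeries.coeff (show FormalMultilinearSeries ℝ ℝ ℍ[ℝ] from
          fun n => ContinuousMultilinearMap.mkPiRing ℝ (Fin n) (c n)) n) =
        fun n => (t : ℍ[ℝ]) ^ n * c n := by
      funext n
      have : FormalMultilinearSeries.coeff (show FormalMultilinearSeries ℝ ℝ ℍ[ℝ] from
          fun n => ContinuousMultilinearMap.mkPiRing ℝ (Fin n) (c n)) n = c n := by
        simp [FormalMultilinearSeries.coeff]
      rw [this, ← Quaternion.coe_pow, Quaternion.coe_mul_eq_smul]
    rw [e]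
    exact hc ⟨(t : ℍ[ℝ]), Ball.mem_iff.2 (by simpa using ht')⟩
  have h := (key a ha).eq_formalMultilinearSeries (key b hb)
  funext n
  have := congrArg (fun p => FormalMultilinearSeries.coeff p n) h
  simpa [FormalMultilinearSeries.coeff] using this

theorem HasSliceExpansion.coeffs_eq {f : Ball → ℍ[ℝ]} {a : ℕ → ℍ[ℝ]}
    (ha : HasSliceExpansion f a) : coeffs f = a := by
  have h : ∃ a, HasSliceExpansion f a := ⟨a, ha⟩
  rw [coeffs, dif_pos h]
  exact h.choose_spec.unique ha

theorem linFun_expansion (a b : ℍ[ℝ]) :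
    HasSliceExpansion (linFun a b) (fun n => if n = 0 then b else if n = 1 then a else 0) := by
  intro q
  have : HasSum (fun n => (q : ℍ[ℝ]) ^ n * (if n = 0 then b else if n = 1 then a else 0))
      (∑ n ∈ Finset.range 2, (q : ℍ[ℝ]) ^ n * (if n = 0 then b else if n = 1 then a else 0)) :=
    hasSum_sum_of_ne_finset_zero (by
    intro n hn
    have : n ≠ 0 ∧ n ≠ 1 := by simp at hn; omega
    simp [this])
  convert this using 1
  simp [Finset.sum_range_succ, linFun, add_comm]


theorem linFun_regConj (a b : ℍ[ℝ]) : regConj (linFun a b) = linFun (star a) (star b) := by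
  funext q
  rw [regConj, (linFun_expansion a b).coeffs_eq, ← (linFun_expansion (star a) (star b) q).tsum_eq]
  refine tsum_congr fun n => ?_
  dsimp only
  split_ifs <;> simp

theorem starMul_linFun {f : Ball → ℍ[ℝ]} {h : ℕ → ℍ[ℝ]} (hf : HasSliceExpansion f h)
    (a b : ℍ[ℝ]) (q : Ball) : starMul f (linFun a b) q = f q * b + q * f q * a := by
  have hconv : ∀ n, ∑ k ∈ Finset.range (n + 2), h k *
      (fun n => if n = 0 then b else if n = 1 then a else 0) (n + 1 - k) = h (n + 1) * b + h n * a := by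
    intro n
    rw [Finset.sum_range_succ, Finset.sum_range_succ, Finset.sum_eq_zero]
    · simp [add_comm]
    · intro k hk
      have hk := Finset.mem_range.1 hk
      have h0 : n + 1 - k ≠ 0 := by omega
      have h1 : n + 1 - k ≠ 1 := by omega
      simp [h0, h1]
  have hs := (hf q).summable
  have hs1 : Summable fun n => (q : ℍ[ℝ]) ^ (n + 1) * h (n + 1) := (summable_nat_add_iff 1).2 hs
  rw [starMul, hf.coeffs_eq, (linFun_expansion a b).coeffs_eq, ← (hf q).tsum_eq]
  have hsum : HasSum (fun n => (q : ℍ[ℝ]) ^ (n + 1) * ∑ k ∈ Finset.range (n + 2), h k *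
      (fun n => if n = 0 then b else if n = 1 then a else 0) (n + 1 - k))
      ((∑' n, (q : ℍ[ℝ]) ^ (n + 1) * h (n + 1)) * b + q * (∑' n, (q : ℍ[ℝ]) ^ n * h n) * a) := by
    simp_rw [hconv]
    have e : (fun n => (q : ℍ[ℝ]) ^ (n + 1) * (h (n + 1) * b + h n * a)) =
        fun n => (q : ℍ[ℝ]) ^ (n + 1) * h (n + 1) * b + q * (q ^ n * h n) * a := by
      funext n
      rw [mul_add, pow_succ']
      simp only [mul_assoc]
    rw [e]
    exact (hs1.hasSum.mul_right b).add ((hs.hasSum.mul_left (q : ℍ[ℝ])).mul_right a)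
  have hsum' := (hasSum_nat_add_iff (f := fun n => (q : ℍ[ℝ]) ^ n * ∑ k ∈ Finset.range (n + 1), h k *
      (fun n => if n = 0 then b else if n = 1 then a else 0) (n - k)) 1).1 hsum
  rw [hsum'.tsum_eq, hs.tsum_eq_zero_add]
  simp [add_mul]
  abel

/-- The symmetrization of `l_{(c,d)}`, written out. -/
def fs (c d : ℍ[ℝ]) (q : ℍ[ℝ]) : ℍ[ℝ] :=
  q ^ 2 * ((Quaternion.normSq c : ℝ) : ℍ[ℝ]) + q * ((2 * (star c * d).re : ℝ) : ℍ[ℝ]) +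
    ((Quaternion.normSq d : ℝ) : ℍ[ℝ])

theorem star_mul_add (c d : ℍ[ℝ]) :
    star c * d + star d * c = ((2 * (star c * d).re : ℝ) : ℍ[ℝ]) := by
  ext <;> simp <;> ring

theorem mul_star_add (c d : ℍ[ℝ]) :
    c * star d + d * star c = ((2 * (star c * d).re : ℝ) : ℍ[ℝ]) := by
  ext <;> simp <;> ring

theorem symmetrization_linFun (c d : ℍ[ℝ]) (q : Ball) : symmetrization (linFun c d) q = fs c d q := by
  rw [symmetrization, linFun_regConj, starMul_linFun (linFun_expansion c d), fs, ← mul_star_add,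
    ← Quaternion.self_mul_star, ← Quaternion.self_mul_star, linFun]
  noncomm_ring

theorem fs_commute (c d q : ℍ[ℝ]) : fs c d q * q = q * fs c d q := by
  rw [fs]
  simp only [add_mul, mul_add]
  congr 1
  · congr 1
    · rw [mul_assoc, Quaternion.coe_commutes, ← mul_assoc, ← mul_assoc, pow_two, mul_assoc q q q]
    · rw [mul_assoc, Quaternion.coe_commutes]
  · rw [Quaternion.coe_commutes]

theorem fs_eq (c d q : ℍ[ℝ]) :
    fs c d q = (q * star c + star d) * d + q * (q * star c + star d) * c := by
  rw [fs, ← star_mul_add, ← Quaternion.star_mul_self, ← Quaternion.star_mul_self]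
  noncomm_ring

theorem linFun_star_ne {c d : ℍ[ℝ]} (h : ‖c‖ < ‖d‖) (q : Ball) :
    (q : ℍ[ℝ]) * star c + star d ≠ 0 := by
  intro h0
  have h1 : ‖(q : ℍ[ℝ])‖ * ‖c‖ = ‖d‖ := by
    rw [← norm_star c, ← norm_mul, ← norm_star d, ← norm_neg (star d), eq_neg_of_add_eq_zero_left h0]
  nlinarith [Ball.norm_lt q, norm_nonneg c, norm_nonneg (q : ℍ[ℝ])]

theorem starInv_expansion {c d : ℍ[ℝ]} (h : ‖c‖ < ‖d‖) :
    HasSliceExpansion (starInv (linFun c d)) (fun n => (-(d⁻¹ * c)) ^ n * d⁻¹) := by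
  intro q
  have hd : d ≠ 0 := by
    rintro rfl
    simp at h
    linarith [norm_nonneg c]
  set H : ℕ → ℍ[ℝ] := fun n => (-(d⁻¹ * c)) ^ n * d⁻¹ with hH
  have hr : ‖(q : ℍ[ℝ])‖ * ‖d⁻¹ * c‖ < 1 := by
    have : ‖d⁻¹ * c‖ < 1 := by
      rw [norm_mul, norm_inv, inv_mul_lt_one₀ (norm_pos_iff.2 hd)]
      exact h
    nlinarith [Ball.norm_lt q, norm_nonneg (q : ℍ[ℝ]), norm_nonneg (d⁻¹ * c)]
  have hsum : ∀ y : ℍ[ℝ], Summable fun n => (q : ℍ[ℝ]) ^ n * (y * H n) := by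
    intro y
    refine Summable.of_norm_bounded
      (((summable_geometric_of_lt_one (by positivity) hr).mul_left (‖y‖ * ‖d⁻¹‖))) fun n => ?_
    rw [norm_mul, norm_mul, hH, norm_mul, norm_pow, norm_pow, norm_neg, mul_pow]
    apply le_of_eq
    ring
  let U : ℍ[ℝ] → ℍ[ℝ] := fun y => ∑' n, (q : ℍ[ℝ]) ^ n * (y * H n)
  have hadd : ∀ y z, U (y + z) = U y + U z := by
    intro y z
    simp only [U]
    rw [← (hsum y).tsum_add (hsum z)]
    simp only [add_mul, mul_add]
  have hreal : ∀ r : ℝ, U (r : ℍ[ℝ]) = (r : ℍ[ℝ]) * U 1 := by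
    intro r
    simp only [U]
    rw [← (hsum 1).tsum_mul_left]
    refine tsum_congr fun n => ?_
    rw [← mul_assoc, ← Quaternion.coe_commutes, one_mul, mul_assoc]
  have hrec : ∀ y, U (y * d) = y - q * U (y * c) := by
    intro y
    simp only [U]
    rw [(hsum (y * d)).tsum_eq_zero_add, ← (hsum (y * c)).tsum_mul_left, sub_eq_add_neg, ← tsum_neg]
    congr 1
    · simp [hH, hd]
    · refine tsum_congr fun n => ?_
      have : d * H (n + 1) = - (c * H n) := by
        simp only [hH, pow_succ', mul_assoc]
        rw [neg_mul, mul_neg, mul_assoc, mul_inv_cancel_left₀ hd]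
      rw [mul_assoc y, this, pow_succ']
      simp only [mul_assoc, mul_neg]
  have hfs : fs c d q * U 1 = q * star c + star d := by
    have e1 := hrec (star c)
    have e2 := hrec (star d)
    rw [Quaternion.star_mul_self, hreal] at e1 e2
    have e3 := hreal (2 * (star c * d).re)
    rw [← star_mul_add, hadd, e1] at e3
    rw [fs, ← star_mul_add, add_mul, add_mul, mul_assoc, mul_assoc, ← e3, e2, pow_two, mul_assoc]
    noncomm_ring
  have hne : fs c d q ≠ 0 := by
    intro h0
    rw [h0, zero_mul] at hfs
    exact linFun_star_ne h q hfs.symm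
  have hS : starInv (linFun c d) q = U 1 := by
    rw [starInv, symmetrization_linFun, linFun_regConj, linFun, ← hfs, inv_mul_cancel_left₀ hne]
  rw [hS]
  have := (hsum 1).hasSum
  simpa [U] using this

theorem Sp11.norm_lt (A : Sp11) : ‖A.1 0 1‖ < ‖A.1 1 1‖ := by
  have := (Sp11.norm_rel A).2.1
  nlinarith [norm_nonneg (A.1 0 1), norm_nonneg (A.1 1 1)]

theorem mobiusFun_eq (A : Sp11) (q : Ball) :
    mobiusFun A q = (fs (A.1 0 1) (A.1 1 1) q)⁻¹ *
      ((q * star (A.1 0 1) + star (A.1 1 1)) * A.1 1 0 +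
        q * (q * star (A.1 0 1) + star (A.1 1 1)) * A.1 0 0) := by
  rw [mobiusFun, starMul_linFun (starInv_expansion (Sp11.norm_lt A)), starInv, symmetrization_linFun,
    linFun_regConj, linFun]
  have hc : (q : ℍ[ℝ]) * (fs (A.1 0 1) (A.1 1 1) q)⁻¹ = (fs (A.1 0 1) (A.1 1 1) q)⁻¹ * q :=
    (Commute.inv_left₀ (fs_commute (A.1 0 1) (A.1 1 1) q : Commute _ _)).eq.symm
  rw [← mul_assoc, hc]
  simp only [mul_add, add_mul, mul_assoc]

theorem mobiusFun_norm_lt (A : Sp11) (q : Ball) : ‖mobiusFun A q‖ < 1 := by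
  rw [mobiusFun_eq, fs_eq]
  have hk := linFun_star_ne (Sp11.norm_lt A) q
  set k := (q : ℍ[ℝ]) * star (A.1 0 1) + star (A.1 1 1) with hkdef
  obtain ⟨-, -, n1, n2⟩ := Sp11.norm_rel A
  have r2 := (Sp11.row_rel A).2.1
  have hq := Ball.norm_lt q
  have hq0 := norm_nonneg (q : ℍ[ℝ])
  have hk0 := norm_pos_iff.2 hk
  have key : ‖k * A.1 1 0 + q * k * A.1 0 0‖ ^ 2 < ‖k * A.1 1 1 + q * k * A.1 0 1‖ ^ 2 := by
    rw [norm_add_sq_real, norm_add_sq_real]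
    have hin : inner ℝ (k * A.1 1 0) (q * k * A.1 0 0) = inner ℝ (k * A.1 1 1) (q * k * A.1 0 1) := by
      rw [Quaternion.inner_def, Quaternion.inner_def]
      have r2' : A.1 1 0 * star (A.1 0 0) = A.1 1 1 * star (A.1 0 1) := by
        have := congrArg star r2
        simpa using this
      rw [star_mul (q * k : ℍ[ℝ]), star_mul (q * k : ℍ[ℝ]), mul_assoc, ← mul_assoc (A.1 1 0), r2']
      simp only [mul_assoc]
    rw [hin]
    simp only [norm_mul, mul_pow]
    have : ‖(q : ℍ[ℝ])‖ ^ 2 * ‖k‖ ^ 2 < ‖k‖ ^ 2 := by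
      have : ‖(q : ℍ[ℝ])‖ ^ 2 < 1 := by nlinarith
      have h2 : 0 < ‖k‖ ^ 2 := by positivity
      nlinarith
    have e1 : ‖A.1 0 0‖ ^ 2 = 1 + ‖A.1 0 1‖ ^ 2 := by linarith
    have e2 : ‖A.1 1 1‖ ^ 2 = 1 + ‖A.1 1 0‖ ^ 2 := by linarith
    rw [e1, e2]
    nlinarith
  have key' := lt_of_pow_lt_pow_left₀ 2 (norm_nonneg _) key
  rw [norm_mul, norm_inv, inv_mul_lt_one₀ (lt_of_le_of_lt (norm_nonneg _) key')]
  exact key'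

/-- `𝓕_A` as a map from the ball to itself. -/
def mobiusMap (A : Sp11) : Ball → Ball := fun q => ⟨mobiusFun A q, Ball.mem_iff.2 (mobiusFun_norm_lt A q)⟩


/-! ### The parametrization of `Sp(1,1)` by `𝔹 × Sp(1) × Sp(1)` -/

/-- The factor `(1 - |a|²)^{-1/2}`. -/
def scal (a : Ball) : ℝ := (√(1 - ‖(a : ℍ[ℝ])‖ ^ 2))⁻¹

theorem scal_pos (a : Ball) : 0 < scal a := by
  have := Ball.norm_lt a
  have h0 := norm_nonneg (a : ℍ[ℝ])
  exact inv_pos.2 (Real.sqrt_pos.2 (by nlinarith))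

theorem scal_sq (a : Ball) : scal a * scal a * (1 - ‖(a : ℍ[ℝ])‖ ^ 2) = 1 := by
  have := Ball.norm_lt a
  have h0 := norm_nonneg (a : ℍ[ℝ])
  have h1 : 0 < 1 - ‖(a : ℍ[ℝ])‖ ^ 2 := by nlinarith
  rw [scal, ← mul_inv, Real.mul_self_sqrt h1.le, inv_mul_cancel₀ h1.ne']

theorem Sp1.star_mul_self (u : Sp1) : star (u : ℍ[ℝ]) * u = 1 := by
  rw [Quaternion.star_mul_self, Quaternion.normSq_eq_norm_mul_self]
  simp

theorem Sp1.self_mul_star (u : Sp1) : (u : ℍ[ℝ]) * star (u : ℍ[ℝ]) = 1 := by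
  rw [Quaternion.self_mul_star, Quaternion.normSq_eq_norm_mul_self]
  simp

/-- The matrix `(1 - |a|²)^{-1/2} ((ū, conj(au)), (a, 1)) w` for `(a, u, w) ∈ 𝔹 × Sp(1) × Sp(1)`. -/
def paramMat (x : Ball × Sp1 × Sp1) : Mat2 :=
  scal x.1 • !![star (x.2.1 : ℍ[ℝ]) * x.2.2, star (x.2.1 : ℍ[ℝ]) * star (x.1 : ℍ[ℝ]) * x.2.2;
    (x.1 : ℍ[ℝ]) * x.2.2, x.2.2]

theorem paramMat_mem (x : Ball × Sp1 × Sp1) : paramMat x ∈ Sp11 := by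
  obtain ⟨a, u, w⟩ := x
  change (paramMat (a, u, w))ᴴ * I11 * paramMat (a, u, w) = I11
  have hu := Sp1.self_mul_star u
  have hw := Sp1.star_mul_self w
  have ha : star (a : ℍ[ℝ]) * a = ((‖(a : ℍ[ℝ])‖ ^ 2 : ℝ) : ℍ[ℝ]) := by
    rw [Quaternion.star_mul_self, Quaternion.normSq_eq_norm_mul_self, pow_two]
  have ha' : (a : ℍ[ℝ]) * star (a : ℍ[ℝ]) = ((‖(a : ℍ[ℝ])‖ ^ 2 : ℝ) : ℍ[ℝ]) := by
    rw [Quaternion.self_mul_star, Quaternion.normSq_eq_norm_mul_self, pow_two]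
  have hs := scal_sq a
  have hs' : (scal a * scal a) • ((1 : ℍ[ℝ]) - ((‖(a : ℍ[ℝ])‖ ^ 2 : ℝ) : ℍ[ℝ])) = 1 := by
    rw [← Quaternion.coe_one, ← Quaternion.coe_sub, ← Quaternion.coe_smul, smul_eq_mul, hs]
  have hr : ∀ r : ℝ, star (w : ℍ[ℝ]) * ((r : ℍ[ℝ]) * w) = r := fun r => by
    rw [Quaternion.coe_commutes, ← mul_assoc, hw, one_mul]
  have huu : ∀ y : ℍ[ℝ], (u : ℍ[ℝ]) * (star (u : ℍ[ℝ]) * y) = y := fun y => by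
    rw [← mul_assoc, hu, one_mul]
  have haa : ∀ y : ℍ[ℝ], star (a : ℍ[ℝ]) * (a * y) = ((‖(a : ℍ[ℝ])‖ ^ 2 : ℝ) : ℍ[ℝ]) * y := fun y => by
    rw [← mul_assoc, ha]
  have haa' : ∀ y : ℍ[ℝ], (a : ℍ[ℝ]) * (star (a : ℍ[ℝ]) * y) = ((‖(a : ℍ[ℝ])‖ ^ 2 : ℝ) : ℍ[ℝ]) * y := fun y => by
    rw [← mul_assoc, ha']
  refine Matrix.ext fun i j => ?_
  fin_cases i <;> fin_cases j
  · simp [paramMat, I11, Matrix.mul_apply, mul_assoc, smul_smul, huu, haa, hw, ← sub_eq_add_neg, ← smul_sub]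
    rw [← Quaternion.coe_pow, hr, hs']
  · simp [paramMat, I11, Matrix.mul_apply, mul_assoc, smul_smul, huu, ← sub_eq_add_neg]
  · simp [paramMat, I11, Matrix.mul_apply, mul_assoc, smul_smul, huu, ← sub_eq_add_neg]
  · simp [paramMat, I11, Matrix.mul_apply, mul_assoc, smul_smul, huu, haa', hw, ← sub_eq_add_neg, ← smul_sub]
    rw [← Quaternion.coe_pow, hr, ← neg_sub, smul_neg, hs']

/-- The bijection `𝔹 × Sp(1) × Sp(1) → Sp(1,1)`. -/
def param (x : Ball × Sp1 × Sp1) : Sp11 := ⟨paramMat x, paramMat_mem x⟩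

theorem Sp11.norm_eq (A : Sp11) : ‖A.1 0 0‖ = ‖A.1 1 1‖ := by
  obtain ⟨h1, h2, h3, h4⟩ := Sp11.norm_rel A
  have : ‖A.1 0 0‖ ^ 2 = ‖A.1 1 1‖ ^ 2 := by linarith
  exact (sq_eq_sq₀ (norm_nonneg _) (norm_nonneg _)).1 this

theorem Sp11.norm_pos (A : Sp11) : 0 < ‖A.1 1 1‖ := lt_of_le_of_lt (norm_nonneg _) (Sp11.norm_lt A)

theorem Sp11.ne_zero (A : Sp11) : A.1 1 1 ≠ 0 := norm_pos_iff.1 (Sp11.norm_pos A)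

/-- The inverse of `param`. -/
def paramInv (A : Sp11) : Ball × Sp1 × Sp1 :=
  (⟨A.1 1 0 * (A.1 1 1)⁻¹, Ball.mem_iff.2 (by
      have h := (Sp11.norm_rel A).2.2.2
      have hp := Sp11.norm_pos A
      rw [norm_mul, norm_inv, mul_inv_lt_iff₀ hp, one_mul]
      nlinarith [norm_nonneg (A.1 1 0)])⟩,
    ⟨(‖A.1 1 1‖ * ‖A.1 0 0‖)⁻¹ • (A.1 1 1 * star (A.1 0 0)), by
      have hp := Sp11.norm_pos A
      have hq := Sp11.norm_eq A
      rw [mem_sphere_zero_iff_norm, norm_smul, norm_mul, norm_star, norm_inv, norm_mul, norm_norm,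
        norm_norm, hq, inv_mul_cancel₀ (by positivity)]⟩,
    ⟨‖A.1 1 1‖⁻¹ • A.1 1 1, by
      have hp := Sp11.norm_pos A
      rw [mem_sphere_zero_iff_norm, norm_smul, norm_inv, norm_norm, inv_mul_cancel₀ hp.ne']⟩)

theorem param_paramInv (A : Sp11) : param (paramInv A) = A := by
  have hp := Sp11.norm_pos A
  have hne := Sp11.ne_zero A
  have hq := Sp11.norm_eq A
  have h4 := (Sp11.norm_rel A).2.2.2
  have hs : scal (paramInv A).1 = ‖A.1 1 1‖ := by
    have : 1 - ‖((paramInv A).1 : ℍ[ℝ])‖ ^ 2 = (‖A.1 1 1‖⁻¹) ^ 2 := by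
      simp only [paramInv, norm_mul, norm_inv]
      field_simp
      exact h4
    rw [scal, this, Real.sqrt_sq (by positivity), inv_inv]
  have hdd : star (A.1 1 1) * A.1 1 1 = ((‖A.1 1 1‖ * ‖A.1 1 1‖ : ℝ) : ℍ[ℝ]) := by
    rw [Quaternion.star_mul_self, Quaternion.normSq_eq_norm_mul_self]
  have hpp : A.1 0 0 * star (A.1 0 0) = ((‖A.1 1 1‖ * ‖A.1 1 1‖ : ℝ) : ℍ[ℝ]) := by
    rw [Quaternion.self_mul_star, Quaternion.normSq_eq_norm_mul_self, hq]
  have hrel := (Sp11.col_rel A).2.1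
  have hdne : star (A.1 1 1) ≠ 0 := by simpa using hne
  apply Subtype.ext
  refine Matrix.ext fun i j => ?_
  change paramMat (paramInv A) i j = A.1 i j
  rw [paramMat, hs]
  fin_cases i <;> fin_cases j
  · simp [paramInv, mul_assoc, smul_smul, hdd, hq]
    rw [← Quaternion.coe_mul, ← Quaternion.coe_commutes, Quaternion.coe_mul_eq_smul, smul_smul]
    field_simp
    simp
  · simp [paramInv, mul_assoc, smul_smul, hq, hdne]
    rw [← hrel, ← mul_assoc (A.1 0 0) (star (A.1 0 0)), hpp, Quaternion.coe_mul_eq_smul, smul_smul]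
    field_simp
    simp
  · simp [paramInv, mul_assoc, smul_smul, hp.ne', hne]
  · simp [paramInv, smul_smul, hp.ne']

theorem paramInv_param (x : Ball × Sp1 × Sp1) : paramInv (param x) = x := by
  obtain ⟨a, u, w⟩ := x
  have hs := scal_pos a
  have hw : ‖(w : ℍ[ℝ])‖ = 1 := by simp
  have hu : ‖(u : ℍ[ℝ])‖ = 1 := by simp
  have hwne : (w : ℍ[ℝ]) ≠ 0 := norm_pos_iff.1 (by rw [hw]; exact one_pos)
  have h11 : (param (a, u, w)).1 1 1 = scal a • (w : ℍ[ℝ]) := by simp [param, paramMat]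
  have h10 : (param (a, u, w)).1 1 0 = scal a • ((a : ℍ[ℝ]) * w) := by simp [param, paramMat]
  have h00 : (param (a, u, w)).1 0 0 = scal a • (star (u : ℍ[ℝ]) * w) := by simp [param, paramMat]
  refine Prod.ext (Subtype.ext ?_) (Prod.ext (Subtype.ext ?_) (Subtype.ext ?_))
  · simp only [paramInv, h11, h10]
    rw [smul_inv₀, smul_mul_smul_comm, mul_inv_cancel₀ hs.ne', one_smul, mul_assoc,
      mul_inv_cancel₀ hwne, mul_one]
  · simp only [paramInv, h11, h00, norm_smul, norm_mul, norm_star, hw, hu]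
    rw [Quaternion.star_smul, star_mul, star_star]
    rw [smul_mul_smul_comm, ← mul_assoc (w : ℍ[ℝ]), Sp1.self_mul_star w, one_mul, smul_smul]
    have e : (scal a * 1 * (scal a * 1))⁻¹ * (scal a * scal a) = 1 := by field_simp
    rw [Real.norm_of_nonneg hs.le, e, one_smul, one_mul]
  · simp only [paramInv, h11, norm_smul, hw, smul_smul]
    simp [abs_of_pos hs, hs.ne']

theorem continuous_scal : Continuous scal := by
  unfold scal
  refine Continuous.inv₀ (by fun_prop) fun a => ?_
  have := scal_pos a
  exact (inv_pos.1 this).ne'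

theorem continuous_param : Continuous param := by
  refine Continuous.subtype_mk ?_ _
  have := continuous_scal
  refine continuous_matrix fun i j => ?_
  unfold paramMat
  fin_cases i <;> fin_cases j <;> simp <;> fun_prop

theorem continuous_paramInv : Continuous paramInv := by
  have he : ∀ i j, Continuous fun A : Sp11 => A.1 i j := fun i j =>
    continuous_subtype_val.matrix_elem i j
  have h0 := he 0 0
  have h1 := he 1 0
  have h2 := he 1 1
  have hn : ∀ A : Sp11, ‖A.1 1 1‖ * ‖A.1 0 0‖ ≠ 0 := fun A => by
    rw [Sp11.norm_eq]; exact (mul_pos (Sp11.norm_pos A) (Sp11.norm_pos A)).ne'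
  refine Continuous.prodMk (Continuous.subtype_mk ?_ _)
    (Continuous.prodMk (Continuous.subtype_mk ?_ _) (Continuous.subtype_mk ?_ _))
  · exact h1.mul (h2.inv₀ Sp11.ne_zero)
  · exact ((h2.norm.mul h0.norm).inv₀ hn).smul (h2.mul h0.star)
  · exact (h2.norm.inv₀ fun A => (Sp11.norm_pos A).ne').smul h2

/-- `param` is a homeomorphism onto `Sp(1,1)` with its subspace topology. -/
def paramHomeo : Ball × Sp1 × Sp1 ≃ₜ Sp11 where
  toFun := param
  invFun := paramInv
  left_inv := paramInv_param
  right_inv := param_paramInv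
  continuous_toFun := continuous_param
  continuous_invFun := continuous_paramInv

/-! ### Transport of a smooth structure along a homeomorphism -/

/-- The charts of `X` are the charts of `Y` composed with `e : X ≃ₜ Y`. -/
@[reducible] def transportChartedSpace {H X Y : Type*} [TopologicalSpace H] [TopologicalSpace X]
    [TopologicalSpace Y] [ChartedSpace H Y] (e : X ≃ₜ Y) : ChartedSpace H X where
  atlas := {c | ∃ c' ∈ atlas H Y, c = e.toOpenPartialHomeomorph.trans c'}
  chartAt x := e.toOpenPartialHomeomorph.trans (chartAt H (e x))
  mem_chart_source x := by simp
  chart_mem_atlas x := ⟨_, chart_mem_atlas H (e x), rfl⟩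

theorem transport_isManifold {E H X Y : Type*} [NormedAddCommGroup E] [NormedSpace ℝ E]
    [TopologicalSpace H] [TopologicalSpace X] [TopologicalSpace Y] [ChartedSpace H Y]
    (I : ModelWithCorners ℝ E H) [hY : IsManifold I ∞ Y] (e : X ≃ₜ Y) :
    @IsManifold ℝ _ E _ _ H _ I ∞ X _ (transportChartedSpace e) := by
  let _ := transportChartedSpace (H := H) e
  have : HasGroupoid X (contDiffGroupoid ∞ I) := by
    refine ⟨?_⟩
    rintro _ _ ⟨c, hc, rfl⟩ ⟨c', hc', rfl⟩
    have h := HasGroupoid.compatible (G := contDiffGroupoid ∞ I) hc hc'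
    refine (contDiffGroupoid ∞ I).mem_of_eqOnSource h ?_
    refine ⟨?_, ?_⟩
    · ext x; simp
    · intro x hx; simp
  exact { toHasGroupoid := this }


/-! ### The set of regular Möbius transformations -/

theorem fs_ne_zero {c d : ℍ[ℝ]} (h : ‖c‖ < ‖d‖) (q : Ball) : fs c d q ≠ 0 := by
  intro h0
  have hk := norm_pos_iff.2 (linFun_star_ne h q)
  rw [fs_eq] at h0
  have h1 := congrArg norm (eq_neg_of_add_eq_zero_left h0)
  rw [norm_neg, norm_mul, norm_mul, norm_mul] at h1
  have hq := Ball.norm_lt q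
  have h2 := mul_lt_mul_of_pos_left h hk
  have h3 : ‖(q : ℍ[ℝ])‖ * ‖(q : ℍ[ℝ]) * star c + star d‖ * ‖c‖ ≤ 
    ‖(q : ℍ[ℝ]) * star c + star d‖ * ‖c‖ := by
    have := mul_le_mul_of_nonneg_right hq.le (mul_nonneg hk.le (norm_nonneg c))
    linarith
  linarith

/-- Denominator in an explicit form of `𝓕_A`. -/
def den (a q : ℍ[ℝ]) : ℍ[ℝ] := (1 - q * a) - q * (1 - q * a) * star a

/-- Numerator in an explicit form of `𝓕_A`. -/
def num (a q : ℍ[ℝ]) : ℍ[ℝ] := q * (1 - q * a) - (1 - q * a) * a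

theorem mobiusFun_param_aux (x : Ball × Sp1 × Sp1) (q : Ball) :
    den x.1 q ≠ 0 ∧ mobiusFun (param x)⁻¹ q = (den x.1 q)⁻¹ * num x.1 q * x.2.1 := by
  obtain ⟨a, u, w⟩ := x
  have hs := scal_pos a
  have hw := Sp1.self_mul_star w
  obtain ⟨i00, i01, i10, i11⟩ := Sp11.inv_apply (param (a, u, w))
  have h00 : (param (a, u, w))⁻¹.1 0 0 = scal a • (star (w : ℍ[ℝ]) * u) := by
    rw [i00]; simp [param, paramMat]
  have h01 : (param (a, u, w))⁻¹.1 0 1 = -(scal a • (star (w : ℍ[ℝ]) * star (a : ℍ[ℝ]))) := by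
    rw [i01]; simp [param, paramMat]
  have h10 : (param (a, u, w))⁻¹.1 1 0 = -(scal a • (star (w : ℍ[ℝ]) * (a * u))) := by
    rw [i10]; simp [param, paramMat]
  have h11 : (param (a, u, w))⁻¹.1 1 1 = scal a • star (w : ℍ[ℝ]) := by
    rw [i11]; simp [param, paramMat]
  have hk : (q : ℍ[ℝ]) * star ((param (a, u, w))⁻¹.1 0 1) + star ((param (a, u, w))⁻¹.1 1 1) =
      scal a • ((1 - q * a) * w) := by
    rw [h01, h11, star_neg, Quaternion.star_smul, Quaternion.star_smul, star_mul, star_star, star_star,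
      mul_neg, mul_smul_comm, sub_mul, one_mul, smul_sub, mul_assoc]
    abel
  have hww : ∀ y : ℍ[ℝ], (w : ℍ[ℝ]) * (star (w : ℍ[ℝ]) * y) = y := fun y => by
    rw [← mul_assoc, hw, one_mul]
  have hne := fs_ne_zero (Sp11.norm_lt (param (a, u, w))⁻¹) q
  have hfs : fs ((param (a, u, w))⁻¹.1 0 1) ((param (a, u, w))⁻¹.1 1 1) q =
      (scal a * scal a) • den a q := by
    rw [fs_eq, hk, h01, h11, den]
    simp only [mul_neg, mul_smul_comm, mul_assoc, hww, hw, smul_mul_assoc, smul_smul,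
      mul_one, smul_sub, ← sub_eq_add_neg]
  rw [hfs] at hne
  refine ⟨fun h => hne (by simp [h]), ?_⟩
  rw [mobiusFun_eq, hfs, hk, h00, h10]
  have : scal a • ((1 - (q : ℍ[ℝ]) * a) * w) * -(scal a • (star (w : ℍ[ℝ]) * (a * u))) +
      q * (scal a • ((1 - (q : ℍ[ℝ]) * a) * w)) * (scal a • (star (w : ℍ[ℝ]) * u)) =
      (scal a * scal a) • (num a q * u) := by
    rw [num]
    simp only [mul_neg, mul_smul_comm, mul_assoc, hww, smul_mul_assoc, smul_smul,
      mul_one, one_mul, smul_sub, sub_mul, mul_sub]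
    abel
  rw [this, smul_inv₀, smul_mul_smul_comm, inv_mul_cancel₀ (by positivity), one_smul, mul_assoc]

theorem den_ne_zero (a q : Ball) : den a q ≠ 0 := (mobiusFun_param_aux (a, 1, 1) q).1

theorem mobiusFun_param (x : Ball × Sp1 × Sp1) (q : Ball) :
    mobiusFun (param x)⁻¹ q = (den x.1 q)⁻¹ * num x.1 q * x.2.1 :=
  (mobiusFun_param_aux x q).2

theorem num_eq_zero {a q : Ball} (h : num a q = 0) : q = a := by
  have h1 : (q : ℍ[ℝ]) - a = q * (q - a) * a := by
    rw [← sub_eq_zero, ← h, num]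
    noncomm_ring
  have h2 := congrArg norm h1
  rw [norm_mul, norm_mul] at h2
  have hq := Ball.norm_lt q
  have ha := Ball.norm_lt a
  by_contra hne
  have h3 : 0 < ‖(q : ℍ[ℝ]) - a‖ := norm_pos_iff.2 (sub_ne_zero.2 fun h => hne (Subtype.ext h))
  have h4 : ‖(q : ℍ[ℝ])‖ * ‖(a : ℍ[ℝ])‖ < 1 := by
    nlinarith [norm_nonneg (q : ℍ[ℝ]), norm_nonneg (a : ℍ[ℝ])]
  nlinarith

theorem num_self (a : Ball) : num a a = 0 := by
  rw [num]; noncomm_ring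

/-- The origin of the ball. -/
instance : Zero Ball := ⟨⟨0, Ball.mem_iff.2 (by simp)⟩⟩

@[simp] theorem Ball.coe_zero : ((0 : Ball) : ℍ[ℝ]) = 0 := rfl

theorem Ball.exists_ne (a : Ball) : ∃ q : Ball, q ≠ a := by
  by_cases h : a = 0
  · refine ⟨⟨((1 / 2 : ℝ) : ℍ[ℝ]), Ball.mem_iff.2 (by rw [Quaternion.norm_coe]; norm_num)⟩, ?_⟩
    rw [h]
    intro h'
    have h2 : ‖((1 / 2 : ℝ) : ℍ[ℝ])‖ = ‖(0 : ℍ[ℝ])‖ := congrArg norm (congrArg Subtype.val h')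
    rw [Quaternion.norm_coe] at h2
    norm_num at h2
  · exact ⟨0, fun h' => h h'.symm⟩

/-- `𝓜(𝔹) = {𝓕_A : A ∈ Sp(1,1)}`, a set of maps from the ball to itself. -/
structure RegMobius where
  toFun : Ball → Ball
  exists_matrix : ∃ A : Sp11, mobiusMap A = toFun

theorem RegMobius.ext_fun {F G : RegMobius} (h : F.toFun = G.toFun) : F = G := by
  cases F; cases G; congr

/-- The natural map `Sp(1,1) → 𝓜(𝔹)`, `A ↦ 𝓕_{A⁻¹}`. -/
def toRegMobius (A : Sp11) : RegMobius := ⟨mobiusMap A⁻¹, A⁻¹, rfl⟩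

theorem toRegMobius_param (x : Ball × Sp1 × Sp1) (q : Ball) :
    (((toRegMobius (param x)).toFun q : Ball) : ℍ[ℝ]) = (den x.1 q)⁻¹ * num x.1 q * x.2.1 :=
  mobiusFun_param x q

theorem toRegMobius_param_eq (a : Ball) (u w w' : Sp1) :
    toRegMobius (param (a, u, w)) = toRegMobius (param (a, u, w')) :=
  RegMobius.ext_fun <| funext fun q => Subtype.ext <| by
    rw [toRegMobius_param, toRegMobius_param]

/-- The map `(a, u) ↦ (1 - q ā)^{-*} * (q - a) u` from `𝔹 × Sp(1)` to `𝓜(𝔹)`. -/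
def phiFun (x : Ball × Sp1) : RegMobius := toRegMobius (param (x.1, x.2, 1))

theorem phiFun_apply (x : Ball × Sp1) (q : Ball) :
    (((phiFun x).toFun q : Ball) : ℍ[ℝ]) = (den x.1 q)⁻¹ * num x.1 q * x.2 :=
  toRegMobius_param _ q

theorem toRegMobius_eq_phiFun (A : Sp11) :
    toRegMobius A = phiFun ((paramInv A).1, (paramInv A).2.1) := by
  conv_lhs => rw [← param_paramInv A]
  exact toRegMobius_param_eq _ _ _ _

theorem phiFun_bijective : Function.Bijective phiFun := by
  constructor
  · rintro ⟨a, u⟩ ⟨a', u'⟩ h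
    have hval : ∀ q : Ball, (den a q)⁻¹ * num a q * u = (den a' q)⁻¹ * num a' q * u' := fun q => by
      rw [← phiFun_apply (a, u), ← phiFun_apply (a', u'), h]
    have ha : a = a' := by
      have h1 := hval a
      rw [num_self, mul_zero, zero_mul] at h1
      have hu' : (u' : ℍ[ℝ]) ≠ 0 := norm_pos_iff.1 (by simp)
      have h2 := (mul_eq_zero.1 ((mul_eq_zero.1 h1.symm).resolve_right hu')).resolve_left
        (inv_ne_zero (den_ne_zero a' a))
      exact num_eq_zero h2
    subst ha
    obtain ⟨q, hq⟩ := Ball.exists_ne a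
    have hne : (den a q)⁻¹ * num a q ≠ 0 :=
      mul_ne_zero (inv_ne_zero (den_ne_zero a q)) fun h => hq (num_eq_zero h)
    exact Prod.ext rfl (Subtype.ext (mul_left_cancel₀ hne (hval q)))
  · rintro ⟨f, A, rfl⟩
    refine ⟨_, (toRegMobius_eq_phiFun A⁻¹).symm.trans ?_⟩
    exact RegMobius.ext_fun (by simp [toRegMobius])

/-- `phiFun` as a bijection. -/
def phi : Ball × Sp1 ≃ RegMobius := Equiv.ofBijective phiFun phiFun_bijective

/-- `𝓜(𝔹)` has the quotient topology of `Sp(1,1) → 𝓜(𝔹)`, `A ↦ 𝓕_{A⁻¹}`. -/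
instance : TopologicalSpace RegMobius := TopologicalSpace.coinduced toRegMobius inferInstance

/-- `phi` is a homeomorphism. -/
def phiHomeo : Ball × Sp1 ≃ₜ RegMobius where
  toEquiv := phi
  continuous_toFun := by
    have h : Continuous toRegMobius := continuous_coinduced_rng
    exact h.comp (continuous_param.comp (by fun_prop : Continuous fun x : Ball × Sp1 => (x.1, x.2, (1 : Sp1))))
  continuous_invFun := by
    refine continuous_coinduced_dom.2 ?_
    have : phi.symm ∘ toRegMobius = fun A => ((paramInv A).1, (paramInv A).2.1) := by
      funext A
      rw [Function.comp_apply, Equiv.symm_apply_eq]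
      exact toRegMobius_eq_phiFun A
    change Continuous (phi.symm ∘ toRegMobius)
    rw [this]
    exact (continuous_fst.comp continuous_paramInv).prodMk
      (continuous_fst.comp (continuous_snd.comp continuous_paramInv))

instance : T2Space RegMobius := phiHomeo.t2Space
instance : SecondCountableTopology RegMobius := phiHomeo.symm.secondCountableTopology

/-- `𝓜(𝔹)₀ = {𝓕 ∈ 𝓜(𝔹) : 𝓕(0) = 0}`, with the subspace topology. -/
def RegMobius₀ : Set RegMobius := {F | F.toFun 0 = 0}

theorem phi_mem (u : Sp1) : phi (0, u) ∈ RegMobius₀ := by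
  refine Subtype.ext ((phiFun_apply (0, u) 0).trans ?_)
  simp [num]

theorem phi_zero_apply (u : Sp1) (q : Ball) : ((phi (0, u)).toFun q : ℍ[ℝ]) = q * u :=
  (phiFun_apply (0, u) q).trans (by simp [num, den])

theorem mem_iff_phi (x : Ball × Sp1) : phi x ∈ RegMobius₀ ↔ x.1 = 0 := by
  constructor
  · intro h
    have h1 := (phiFun_apply x 0).symm.trans (congrArg Subtype.val h)
    have hu : (x.2 : ℍ[ℝ]) ≠ 0 := norm_pos_iff.1 (by simp)
    simpa [num, den, hu, Subtype.ext_iff] using h1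
  · intro h
    have : x = (0, x.2) := Prod.ext h rfl
    rw [this]
    exact phi_mem _

/-- `u ↦ R_u`, where `R_u(q) = q u`, is a homeomorphism `Sp(1) → 𝓜(𝔹)₀`. -/
def phi₀Homeo : Sp1 ≃ₜ RegMobius₀ where
  toFun u := ⟨phi (0, u), phi_mem u⟩
  invFun F := (phi.symm F).2
  left_inv u := by simp
  right_inv F := by
    apply Subtype.ext
    have h : phi (phi.symm F) ∈ RegMobius₀ := by simp
    have h0 := (mem_iff_phi _).1 h
    change phi (0, (phi.symm F).2) = F
    rw [← h0, Prod.mk.eta, Equiv.apply_symm_apply]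
  continuous_toFun := Continuous.subtype_mk (phiHomeo.continuous.comp (by fun_prop)) _
  continuous_invFun := continuous_snd.comp (phiHomeo.symm.continuous.comp continuous_subtype_val)

theorem phi_comp (v : Sp1) (x : Ball × Sp1) :
    (phi (0, v)).toFun ∘ (phi x).toFun = (phi (x.1, x.2 * v)).toFun := by
  funext q
  apply Subtype.ext
  rw [Function.comp_apply, phi_zero_apply]
  refine Eq.trans ?_ (phiFun_apply _ q).symm
  refine (congrArg (· * (v : ℍ[ℝ])) (phiFun_apply x q)).trans ?_
  simp [mul_assoc]

theorem comp_exists (F₀ : RegMobius₀) (F : RegMobius) :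
    ∃ A : Sp11, mobiusMap A = F₀.1.toFun ∘ F.toFun := by
  have h0 : F₀.1 = phi (0, phi₀Homeo.symm F₀) :=
    (congrArg Subtype.val (phi₀Homeo.apply_symm_apply F₀)).symm
  rw [h0, ← phi.apply_symm_apply F, phi_comp]
  exact (phi _).exists_matrix

/-- `𝓕₀ • 𝓕 = 𝓕₀ ∘ 𝓕`. -/
instance : SMul RegMobius₀ RegMobius where
  smul F₀ F := ⟨F₀.1.toFun ∘ F.toFun, comp_exists F₀ F⟩

/-- The product of `𝓜(𝔹)₀` is the composition of maps. -/
instance : Mul RegMobius₀ where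
  mul F G := ⟨F • G.1, by
    change F.1.toFun (G.1.toFun 0) = 0
    rw [show G.1.toFun 0 = 0 from G.2, show F.1.toFun 0 = 0 from F.2]⟩

theorem phi_one : (phi (0, 1)).toFun = id := by
  funext q
  exact Subtype.ext ((phi_zero_apply 1 q).trans (by simp))

/-- The neutral element of `𝓜(𝔹)₀` is the identity map. -/
instance : One RegMobius₀ where
  one := ⟨⟨id, phi_one ▸ (phi (0, 1)).exists_matrix⟩, rfl⟩

theorem phi₀_one : phi₀Homeo 1 = 1 := Subtype.ext (RegMobius.ext_fun phi_one)

theorem phi₀_mul (u v : Sp1) : phi₀Homeo u * phi₀Homeo v = phi₀Homeo (v * u) :=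
  Subtype.ext (RegMobius.ext_fun (phi_comp u (0, v)))

/-- `R_u⁻¹ = R_{u⁻¹}`. -/
instance : Inv RegMobius₀ where
  inv F := phi₀Homeo (phi₀Homeo.symm F)⁻¹

/-- `𝓜(𝔹)₀` is a group under composition. -/
instance : Group RegMobius₀ :=
  Group.ofLeftAxioms (fun _ _ _ => rfl) (fun _ => rfl) fun F => by
    change phi₀Homeo (phi₀Homeo.symm F)⁻¹ * F = 1
    conv_lhs => rw [← phi₀Homeo.apply_symm_apply F]
    rw [phi₀_mul, Homeomorph.symm_apply_apply, mul_inv_cancel, phi₀_one]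

/-- The action of `𝓜(𝔹)₀` on `𝓜(𝔹)` by composition. -/
instance : MulAction RegMobius₀ RegMobius where
  one_smul _ := rfl
  mul_smul _ _ _ := rfl

/-! ### Smooth structures

The charts below come from parametrizations. That they give the submanifold structure of `Sp(1,1)` in
`M₂(ℍ)`, the quotient structure of `𝓜(𝔹)` and the submanifold structure of `𝓜(𝔹)₀` in `𝓜(𝔹)` is
not built into the definitions: it is to be expressed with `IsEmbeddedSubmanifoldMap` and
`IsSmoothSubmersion`, which determine the structures. -/

/-- `ℝ³`. -/
abbrev E3 : Type := EuclideanSpace ℝ (Fin 3)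

/-- The model of the `10`-dimensional manifold `Sp(1,1)`. -/
abbrev modelSp11 := 𝓘(ℝ, ℍ[ℝ]).prod ((𝓡 3).prod (𝓡 3))

/-- The model of the `7`-dimensional manifold `𝓜(𝔹)`. -/
abbrev modelRegMobius := 𝓘(ℝ, ℍ[ℝ]).prod (𝓡 3)

instance : ChartedSpace (ModelProd ℍ[ℝ] (ModelProd E3 E3)) Sp11 :=
  transportChartedSpace paramHomeo.symm

instance : IsManifold modelSp11 ∞ Sp11 := transport_isManifold _ paramHomeo.symm

instance : ChartedSpace (ModelProd ℍ[ℝ] E3) RegMobius := transportChartedSpace phiHomeo.symm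

instance : IsManifold modelRegMobius ∞ RegMobius := transport_isManifold _ phiHomeo.symm

instance : ChartedSpace E3 RegMobius₀ := transportChartedSpace phi₀Homeo.symm

instance : IsManifold (𝓡 3) ∞ RegMobius₀ := transport_isManifold _ phi₀Homeo.symm

section

variable {E H M E' H' M' : Type*} [NormedAddCommGroup E] [NormedSpace ℝ E] [TopologicalSpace H]
  [TopologicalSpace M] [ChartedSpace H M] [NormedAddCommGroup E'] [NormedSpace ℝ E']
  [TopologicalSpace H'] [TopologicalSpace M'] [ChartedSpace H' M']

/-- `f` embeds the manifold `M` as an embedded submanifold of `M'`: it is smooth, a homeomorphism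
onto its image, and has injective differential at every point. -/
def IsEmbeddedSubmanifoldMap (I : ModelWithCorners ℝ E H) (I' : ModelWithCorners ℝ E' H')
    (f : M → M') : Prop :=
  ContMDiff I I' ∞ f ∧ Topology.IsEmbedding f ∧ ∀ x, Function.Injective (mfderiv I I' f x)

/-- `f` is a submersion: a surjective smooth map with surjective differential at every point. -/
def IsSmoothSubmersion (I : ModelWithCorners ℝ E H) (I' : ModelWithCorners ℝ E' H')
    (f : M → M') : Prop :=
  ContMDiff I I' ∞ f ∧ Function.Surjective f ∧ ∀ x, Function.Surjective (mfderiv I I' f x)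

end

/-- A proper action: for every compact `K` the set of `g` with `g K ∩ K ≠ ∅` is compact. -/
def IsProperAction (G X : Type*) [TopologicalSpace G] [TopologicalSpace X] [SMul G X] : Prop :=
  ∀ K : Set X, IsCompact K → IsCompact {g : G | ((fun x => g • x) '' K ∩ K).Nonempty}

/-- A free action: only the identity element fixes some point. -/
def IsFreeAction (G X : Type*) [One G] [SMul G X] : Prop :=
  ∀ (g : G) (x : X), g • x = x → g = 1

end SliceMobius

end

open SliceMobius

/-!
In suitable coordinates everything becomes a statement about products. A matrix of `Sp(1,1)` is
determined by a point of `𝔹` and two unit quaternions `u`, `w`, a regular Möbius transformation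
`(1 - q ā)^{-*} * (q - a) u` by the pair `(a, u) ∈ 𝔹 × Sp(1)`, and an element `q ↦ q u` of `𝓜(𝔹)₀`
by `u ∈ Sp(1)`. Then `A ↦ 𝓕_{A⁻¹}` forgets `w`, the inclusion of `𝓜(𝔹)₀` is `u ↦ (0, u)`, and the
action of `q ↦ q v` is `(a, u) ↦ (a, u v)`. The last formula makes the action smooth and free; it
is proper because `Sp(1)` is compact. The inclusion of `Sp(1,1)` in `M₂(ℍ)` is an immersion because
the coordinates of a matrix extend to functions differentiable near `Sp(1,1)`.
-/

noncomputable section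

namespace SliceMobius

section Transport

variable {𝕜 E H X Y : Type*} [NontriviallyNormedField 𝕜] [NormedAddCommGroup E] [NormedSpace 𝕜 E]
  [TopologicalSpace H] [TopologicalSpace X] [TopologicalSpace Y] [ChartedSpace H Y]
  (I : ModelWithCorners 𝕜 E H) (n : ℕ∞ω) (e : X ≃ₜ Y)

theorem contMDiff_transport :
    letI := transportChartedSpace (H := H) e
    ContMDiff I I n e := by
  let := transportChartedSpace (H := H) e
  refine fun x => contMDiffAt_iff.2 ⟨e.continuous.continuousAt, ?_⟩
  refine contDiffWithinAt_id.congr_of_eventuallyEq_of_mem ?_ (Set.mem_range_self _)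
  filter_upwards [extChartAt_target_mem_nhdsWithin (I := I) (x := x)] with z hz
  -- The chart of `X` at `x` is by definition the chart of `Y` at `e x` composed with `e`.
  exact (extChartAt I x).right_inv hz

theorem contMDiff_transport_symm :
    letI := transportChartedSpace (H := H) e
    ContMDiff I I n e.symm := by
  let := transportChartedSpace (H := H) e
  intro y
  obtain ⟨x, rfl⟩ := e.surjective y
  refine contMDiffAt_iff.2 ⟨e.symm.continuous.continuousAt, ?_⟩
  rw [e.symm_apply_apply]
  refine contDiffWithinAt_id.congr_of_eventuallyEq_of_mem ?_ (Set.mem_range_self _)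
  filter_upwards [extChartAt_target_mem_nhdsWithin (I := I) (x := x)] with z hz
  exact (extChartAt I x).right_inv hz

/-- A homeomorphism as a diffeomorphism for the transported charts on its source. -/
def transportDiffeomorph :
    letI := transportChartedSpace (H := H) e
    X ≃ₘ^n⟮I, I⟯ Y :=
  letI := transportChartedSpace (H := H) e
  { toEquiv := e.toEquiv
    contMDiff_toFun := contMDiff_transport I n e
    contMDiff_invFun := contMDiff_transport_symm I n e }

end Transport

section Differential

variable {𝕜 E H M E' H' M' F G N : Type*} [NontriviallyNormedField 𝕜]
  [NormedAddCommGroup E] [NormedSpace 𝕜 E] [TopologicalSpace H] [TopologicalSpace M]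
  [ChartedSpace H M] [NormedAddCommGroup E'] [NormedSpace 𝕜 E'] [TopologicalSpace H']
  [TopologicalSpace M'] [ChartedSpace H' M'] [NormedAddCommGroup F] [NormedSpace 𝕜 F]
  [TopologicalSpace G] [TopologicalSpace N] [ChartedSpace G N]
  {I : ModelWithCorners 𝕜 E H} {I' : ModelWithCorners 𝕜 E' H'} {J : ModelWithCorners 𝕜 F G}

theorem mfderiv_injective_of_comp {f : M → M'} {g : M' → N} {x : M}
    (hg : MDifferentiableAt I' J g (f x)) (hf : MDifferentiableAt I I' f x)
    (h : Function.Injective (mfderiv I J (g ∘ f) x)) :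
    Function.Injective (mfderiv I I' f x) := by
  rw [mfderiv_comp x hg hf] at h
  exact Function.Injective.of_comp h

theorem mfderiv_opens_val_injective {U : TopologicalSpace.Opens M} (x : U) :
    Function.Injective (mfderiv I I (Subtype.val : U → M) x) := by
  let r : M → U := Function.extend Subtype.val id fun _ => x
  have hr : r ∘ Subtype.val = id := Function.extend_comp Subtype.val_injective _ _
  have hr' : ContMDiffAt I I 1 r x := by
    refine contMDiffAt_subtype_iff.1 ?_
    change ContMDiffAt I I 1 (r ∘ Subtype.val) x
    rw [hr]
    exact contMDiffAt_id
  refine mfderiv_injective_of_comp (hr'.mdifferentiableAt one_ne_zero)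
    ((contMDiff_subtype_val (n := 1) x).mdifferentiableAt one_ne_zero) ?_
  rw [hr, mfderiv_id]
  exact Function.injective_id

end Differential

section EmbeddingsAndSubmersions

variable {E H M E' H' M' F G N F' G' N' : Type*}
  [NormedAddCommGroup E] [NormedSpace ℝ E] [TopologicalSpace H] [TopologicalSpace M]
  [ChartedSpace H M] [NormedAddCommGroup E'] [NormedSpace ℝ E'] [TopologicalSpace H']
  [TopologicalSpace M'] [ChartedSpace H' M'] [NormedAddCommGroup F] [NormedSpace ℝ F]
  [TopologicalSpace G] [TopologicalSpace N] [ChartedSpace G N]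
  [NormedAddCommGroup F'] [NormedSpace ℝ F'] [TopologicalSpace G'] [TopologicalSpace N']
  [ChartedSpace G' N']
  {I : ModelWithCorners ℝ E H} {I' : ModelWithCorners ℝ E' H'} {J : ModelWithCorners ℝ F G}
  {J' : ModelWithCorners ℝ F' G'}

namespace IsEmbeddedSubmanifoldMap

theorem mdifferentiable {f : M → M'} (hf : IsEmbeddedSubmanifoldMap I I' f) :
    MDifferentiable I I' f :=
  hf.1.mdifferentiable (by simp)

theorem comp {g : M' → N} {f : M → M'} (hg : IsEmbeddedSubmanifoldMap I' J g)
    (hf : IsEmbeddedSubmanifoldMap I I' f) : IsEmbeddedSubmanifoldMap I J (g ∘ f) := by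
  refine ⟨hg.1.comp hf.1, hg.2.1.comp hf.2.1, fun x => ?_⟩
  rw [mfderiv_comp x (hg.mdifferentiable _) (hf.mdifferentiable x)]
  exact (hg.2.2 _).comp (hf.2.2 x)

theorem prodMap {f : M → M'} {g : N → N'} (hf : IsEmbeddedSubmanifoldMap I I' f)
    (hg : IsEmbeddedSubmanifoldMap J J' g) :
    IsEmbeddedSubmanifoldMap (I.prod J) (I'.prod J') (Prod.map f g) := by
  refine ⟨hf.1.prodMap hg.1, hf.2.1.prodMap hg.2.1, fun x => ?_⟩
  rw [mfderiv_prodMap (hf.mdifferentiable _) (hg.mdifferentiable _)]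
  exact (hf.2.2 _).prodMap (hg.2.2 _)

theorem of_diffeomorph (Φ : M ≃ₘ⟮I, I'⟯ M') : IsEmbeddedSubmanifoldMap I I' Φ :=
  ⟨Φ.contMDiff, Φ.toHomeomorph.isEmbedding,
    fun x => (Φ.mfderivToContinuousLinearEquiv (by simp) x).injective⟩

theorem prodMk_right (c : M) : IsEmbeddedSubmanifoldMap I' (I.prod I') (Prod.mk c : M' → M × M') :=
  ⟨contMDiff_const.prodMk contMDiff_id, isEmbedding_prodMkRight c, fun y => by
    rw [mfderiv_prod_right]
    exact LinearMap.inr_injective⟩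

theorem opens_val (U : TopologicalSpace.Opens M) :
    IsEmbeddedSubmanifoldMap I I (Subtype.val : U → M) :=
  ⟨contMDiff_subtype_val, Topology.IsEmbedding.subtypeVal, mfderiv_opens_val_injective⟩

theorem sphere_val {V : Type*} [NormedAddCommGroup V] [InnerProductSpace ℝ V] {n : ℕ}
    [Fact (Module.finrank ℝ V = n + 1)] :
    IsEmbeddedSubmanifoldMap (𝓡 n) 𝓘(ℝ, V) (Subtype.val : Metric.sphere (0 : V) 1 → V) :=
  ⟨contMDiff_coe_sphere, Topology.IsEmbedding.subtypeVal, injective_mvfderiv_subtypeVal_sphere⟩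

end IsEmbeddedSubmanifoldMap

namespace IsSmoothSubmersion

theorem mdifferentiable {f : M → M'} (hf : IsSmoothSubmersion I I' f) : MDifferentiable I I' f :=
  hf.1.mdifferentiable (by simp)

theorem comp {g : M' → N} {f : M → M'} (hg : IsSmoothSubmersion I' J g)
    (hf : IsSmoothSubmersion I I' f) : IsSmoothSubmersion I J (g ∘ f) := by
  refine ⟨hg.1.comp hf.1, hg.2.1.comp hf.2.1, fun x => ?_⟩
  rw [mfderiv_comp x (hg.mdifferentiable _) (hf.mdifferentiable x)]
  exact (hg.2.2 _).comp (hf.2.2 x)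

theorem prodMap {f : M → M'} {g : N → N'} (hf : IsSmoothSubmersion I I' f)
    (hg : IsSmoothSubmersion J J' g) :
    IsSmoothSubmersion (I.prod J) (I'.prod J') (Prod.map f g) := by
  refine ⟨hf.1.prodMap hg.1, hf.2.1.prodMap hg.2.1, fun x => ?_⟩
  rw [mfderiv_prodMap (hf.mdifferentiable _) (hg.mdifferentiable _)]
  exact (hf.2.2 _).prodMap (hg.2.2 _)

theorem of_diffeomorph (Φ : M ≃ₘ⟮I, I'⟯ M') : IsSmoothSubmersion I I' Φ :=
  ⟨Φ.contMDiff, Φ.surjective,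
    fun x => (Φ.mfderivToContinuousLinearEquiv (by simp) x).surjective⟩

theorem fst [Nonempty M'] : IsSmoothSubmersion (I.prod I') I (Prod.fst : M × M' → M) :=
  ⟨contMDiff_fst, Prod.fst_surjective, fun x => by
    rw [mfderiv_fst]
    exact Prod.fst_surjective⟩

end IsSmoothSubmersion

end EmbeddingsAndSubmersions

instance contMDiffMul_normedAlgebra {𝕜 R : Type*} [NontriviallyNormedField 𝕜] [NormedRing R]
    [NormedAlgebra 𝕜 R] (n : ℕ∞ω) : ContMDiffMul 𝓘(𝕜, R) n R where
  contMDiff_mul := by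
    rw [← modelWithCornersSelf_prod, chartedSpaceSelf_prod]
    exact contDiff_mul.contMDiff

theorem contDiffAt_inv_normedDivisionRing {𝕜 R : Type*} [NontriviallyNormedField 𝕜]
    [NormedDivisionRing R] [NormedAlgebra 𝕜 R] [HasSummableGeomSeries R] (n : ℕ∞ω) {x : R}
    (hx : x ≠ 0) : ContDiffAt 𝕜 n (fun y : R => y⁻¹) x := by
  have h := contDiffAt_ringInverse 𝕜 (n := n) (Units.mk0 x hx)
  rwa [Ring.inverse_eq_inv'] at h

theorem contDiff_quaternion_star (n : ℕ∞ω) : ContDiff ℝ n (star : ℍ[ℝ] → ℍ[ℝ]) :=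
  (LinearMap.toContinuousLinearMap
    { toFun := star, map_add' := star_add, map_smul' := Quaternion.star_smul } :
      ℍ[ℝ] →L[ℝ] ℍ[ℝ]).contDiff

instance lieGroup_sp1 (n : ℕ∞ω) : LieGroup (𝓡 3) n Sp1 where
  contMDiff_mul := ContMDiff.codRestrict_sphere
    ((contMDiff_coe_sphere.comp contMDiff_fst).mul (contMDiff_coe_sphere.comp contMDiff_snd))
    fun p => (p.1 * p.2).2
  contMDiff_inv := by
    have hinv : ContMDiff (𝓡 3) 𝓘(ℝ, ℍ[ℝ]) n fun u : Sp1 => (u : ℍ[ℝ])⁻¹ := fun u =>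
      (contDiffAt_inv_normedDivisionRing n (ne_zero_of_mem_unit_sphere u)).contMDiffAt.comp u
        (contMDiff_coe_sphere u)
    exact hinv.codRestrict_sphere fun u => u⁻¹.2

theorem contMDiff_scal : ContMDiff 𝓘(ℝ, ℍ[ℝ]) 𝓘(ℝ, ℝ) ∞ scal := fun a => by
  have hs : √(1 - ‖(a : ℍ[ℝ])‖ ^ 2) ≠ 0 := (inv_pos.1 (scal_pos a)).ne'
  have hne : 1 - ‖(a : ℍ[ℝ])‖ ^ 2 ≠ 0 := fun h => hs (by rw [h, Real.sqrt_zero])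
  have h : ContDiffAt ℝ ∞ (fun x : ℍ[ℝ] => (√(1 - ‖x‖ ^ 2))⁻¹) a :=
    ((contDiffAt_const.sub (contDiff_norm_sq ℝ).contDiffAt).sqrt hne).inv hs
  exact h.contMDiffAt.comp a (contMDiff_subtype_val a)

theorem contMDiff_paramMat : ContMDiff modelSp11 𝓘(ℝ, Fin 2 → Fin 2 → ℍ[ℝ]) ∞
    (fun (x : Ball × Sp1 × Sp1) (i j : Fin 2) => paramMat x i j) := by
  have ha : ContMDiff modelSp11 𝓘(ℝ, ℍ[ℝ]) ∞ fun x : Ball × Sp1 × Sp1 => (x.1 : ℍ[ℝ]) :=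
    contMDiff_subtype_val.comp contMDiff_fst
  have hu : ContMDiff modelSp11 𝓘(ℝ, ℍ[ℝ]) ∞ fun x : Ball × Sp1 × Sp1 => (x.2.1 : ℍ[ℝ]) :=
    contMDiff_coe_sphere.comp (contMDiff_fst.comp contMDiff_snd)
  have hw : ContMDiff modelSp11 𝓘(ℝ, ℍ[ℝ]) ∞ fun x : Ball × Sp1 × Sp1 => (x.2.2 : ℍ[ℝ]) :=
    contMDiff_coe_sphere.comp (contMDiff_snd.comp contMDiff_snd)
  have hs : ContMDiff modelSp11 𝓘(ℝ, ℝ) ∞ fun x : Ball × Sp1 × Sp1 => scal x.1 :=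
    contMDiff_scal.comp contMDiff_fst
  have hstar : ContMDiff 𝓘(ℝ, ℍ[ℝ]) 𝓘(ℝ, ℍ[ℝ]) ∞ (star : ℍ[ℝ] → ℍ[ℝ]) :=
    (contDiff_quaternion_star ∞).contMDiff
  refine contMDiff_pi_space.2 fun i => contMDiff_pi_space.2 fun j => ?_
  fin_cases i <;> fin_cases j
  · exact hs.smul ((hstar.comp hu).mul hw)
  · exact hs.smul (((hstar.comp hu).mul (hstar.comp ha)).mul hw)
  · exact hs.smul (ha.mul hw)
  · exact hs.smul hw

/-- The formula of `paramInv` on all of `M₂(ℍ)`: it provides the differentiable extensions of the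
coordinates of `Sp(1,1)`. With `0⁻¹ = 0` it is meaningful only where the diagonal entries are
nonzero, which is the case near `Sp(1,1)`. -/
def paramInvExt (A : Fin 2 → Fin 2 → ℍ[ℝ]) : ℍ[ℝ] × ℍ[ℝ] × ℍ[ℝ] :=
  (A 1 0 * (A 1 1)⁻¹, (‖A 1 1‖ * ‖A 0 0‖)⁻¹ • (A 1 1 * star (A 0 0)), ‖A 1 1‖⁻¹ • A 1 1)

theorem mdifferentiableAt_paramInvExt {A : Fin 2 → Fin 2 → ℍ[ℝ]} (h0 : A 0 0 ≠ 0)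
    (h1 : A 1 1 ≠ 0) : MDifferentiableAt 𝓘(ℝ, Fin 2 → Fin 2 → ℍ[ℝ])
      (𝓘(ℝ, ℍ[ℝ]).prod (𝓘(ℝ, ℍ[ℝ]).prod 𝓘(ℝ, ℍ[ℝ]))) paramInvExt A := by
  have entry (i j) : ContDiffAt ℝ 1 (fun B : Fin 2 → Fin 2 → ℍ[ℝ] => B i j) A :=
    contDiffAt_pi.1 (contDiffAt_pi.1 contDiffAt_id i) j
  have norm0 := (entry 0 0).norm ℝ h0
  have norm1 := (entry 1 1).norm ℝ h1
  have ball_coord := (entry 1 0).mul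
    ((contDiffAt_inv_normedDivisionRing 1 h1).comp A (entry 1 1))
  have u_coord := ((norm1.mul norm0).inv (by simp [h0, h1])).smul
    ((entry 1 1).mul ((contDiff_quaternion_star 1).contDiffAt.comp A (entry 0 0)))
  have w_coord := (norm1.inv (norm_ne_zero_iff.2 h1)).smul (entry 1 1)
  exact (ball_coord.contMDiffAt.mdifferentiableAt one_ne_zero).prodMk
    ((u_coord.contMDiffAt.mdifferentiableAt one_ne_zero).prodMk
      (w_coord.contMDiffAt.mdifferentiableAt one_ne_zero))

/-- `paramHomeo` as a diffeomorphism, giving the coordinates of `Sp(1,1)`. -/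
def paramDiffeo : (Ball × Sp1 × Sp1) ≃ₘ⟮modelSp11, modelSp11⟯ Sp11 :=
  (transportDiffeomorph modelSp11 ∞ paramHomeo.symm).symm

/-- `phiHomeo` as a diffeomorphism, giving the coordinates of `𝓜(𝔹)`. -/
def phiDiffeo : (Ball × Sp1) ≃ₘ⟮modelRegMobius, modelRegMobius⟯ RegMobius :=
  (transportDiffeomorph modelRegMobius ∞ phiHomeo.symm).symm

/-- `phi₀Homeo` as a diffeomorphism, giving the coordinates of `𝓜(𝔹)₀`. -/
def phi₀Diffeo : Sp1 ≃ₘ⟮𝓡 3, 𝓡 3⟯ RegMobius₀ :=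
  (transportDiffeomorph (𝓡 3) ∞ phi₀Homeo.symm).symm

theorem contMDiff_sp11_val : ContMDiff modelSp11 𝓘(ℝ, Fin 2 → Fin 2 → ℍ[ℝ]) ∞
    (fun (A : Sp11) (i j : Fin 2) => A.1 i j) :=
  (contMDiff_paramMat.comp paramDiffeo.symm.contMDiff).congr fun A =>
    congrArg (fun (B : Sp11) (i j : Fin 2) => B.1 i j) (param_paramInv A).symm

theorem isEmbeddedSubmanifoldMap_sp11 :
    IsEmbeddedSubmanifoldMap modelSp11 𝓘(ℝ, Fin 2 → Fin 2 → ℍ[ℝ])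
      (fun (A : Sp11) (i j : Fin 2) => A.1 i j) := by
  have coordinates : IsEmbeddedSubmanifoldMap modelSp11
      (𝓘(ℝ, ℍ[ℝ]).prod (𝓘(ℝ, ℍ[ℝ]).prod 𝓘(ℝ, ℍ[ℝ])))
      (paramInvExt ∘ fun (A : Sp11) (i j : Fin 2) => A.1 i j) :=
    ((IsEmbeddedSubmanifoldMap.opens_val Ball).prodMap
      (IsEmbeddedSubmanifoldMap.sphere_val.prodMap IsEmbeddedSubmanifoldMap.sphere_val)).comp
        (IsEmbeddedSubmanifoldMap.of_diffeomorph paramDiffeo.symm)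
  refine ⟨contMDiff_sp11_val, Topology.IsEmbedding.subtypeVal, fun A => ?_⟩
  have h0 : A.1 0 0 ≠ 0 := norm_pos_iff.1 (by rw [Sp11.norm_eq]; exact Sp11.norm_pos A)
  exact mfderiv_injective_of_comp (mdifferentiableAt_paramInvExt h0 (Sp11.ne_zero A))
    (contMDiff_sp11_val.mdifferentiable (by simp) A) (coordinates.2.2 A)

theorem isSmoothSubmersion_toRegMobius :
    IsSmoothSubmersion modelSp11 modelRegMobius toRegMobius := by
  have h : toRegMobius = phiDiffeo ∘ Prod.map id Prod.fst ∘ paramDiffeo.symm :=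
    funext toRegMobius_eq_phiFun
  rw [h]
  exact (IsSmoothSubmersion.of_diffeomorph phiDiffeo).comp
    (((IsSmoothSubmersion.of_diffeomorph (Diffeomorph.refl _ _ _)).prodMap
      IsSmoothSubmersion.fst).comp (IsSmoothSubmersion.of_diffeomorph paramDiffeo.symm))

theorem isEmbeddedSubmanifoldMap_regMobius₀ :
    IsEmbeddedSubmanifoldMap (𝓡 3) modelRegMobius (Subtype.val : RegMobius₀ → RegMobius) := by
  have h : Subtype.val = phiDiffeo ∘ Prod.mk 0 ∘ phi₀Diffeo.symm := funext fun F₀ =>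
    (congrArg Subtype.val (phi₀Diffeo.apply_symm_apply F₀)).symm
  rw [h]
  exact (IsEmbeddedSubmanifoldMap.of_diffeomorph phiDiffeo).comp
    ((IsEmbeddedSubmanifoldMap.prodMk_right 0).comp
      (IsEmbeddedSubmanifoldMap.of_diffeomorph phi₀Diffeo.symm))

theorem mul_eq_phi₀ (F₀ G₀ : RegMobius₀) :
    F₀ * G₀ = phi₀Diffeo (phi₀Diffeo.symm G₀ * phi₀Diffeo.symm F₀) := by
  conv_lhs => rw [← phi₀Diffeo.apply_symm_apply F₀, ← phi₀Diffeo.apply_symm_apply G₀]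
  exact phi₀_mul _ _

theorem lieGroup_regMobius₀ : LieGroup (𝓡 3) ∞ RegMobius₀ where
  contMDiff_mul := by
    simp only [mul_eq_phi₀]
    exact phi₀Diffeo.contMDiff.comp ((phi₀Diffeo.symm.contMDiff.comp contMDiff_snd).mul
      (phi₀Diffeo.symm.contMDiff.comp contMDiff_fst))
  contMDiff_inv := phi₀Diffeo.contMDiff.comp phi₀Diffeo.symm.contMDiff.inv

theorem smul_eq_phi (F₀ : RegMobius₀) (F : RegMobius) : F₀ • F =
    phiDiffeo ((phiDiffeo.symm F).1, (phiDiffeo.symm F).2 * phi₀Diffeo.symm F₀) := by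
  conv_lhs => rw [← phi₀Diffeo.apply_symm_apply F₀, ← phiDiffeo.apply_symm_apply F]
  exact RegMobius.ext_fun (phi_comp _ _)

theorem contMDiff_smul_regMobius : ContMDiff ((𝓡 3).prod modelRegMobius) modelRegMobius ∞
    (fun p : RegMobius₀ × RegMobius => p.1 • p.2) := by
  have hF : ContMDiff ((𝓡 3).prod modelRegMobius) modelRegMobius ∞
      fun p : RegMobius₀ × RegMobius => phiDiffeo.symm p.2 :=
    phiDiffeo.symm.contMDiff.comp contMDiff_snd
  simp only [smul_eq_phi]
  exact phiDiffeo.contMDiff.comp (hF.fst.prodMk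
    (hF.snd.mul (phi₀Diffeo.symm.contMDiff.comp contMDiff_fst)))

theorem isFreeAction_regMobius : IsFreeAction RegMobius₀ RegMobius := by
  intro F₀ F h
  have hcoord := congrArg phiDiffeo.symm h
  rw [smul_eq_phi, phiDiffeo.symm_apply_apply] at hcoord
  have hu : phi₀Diffeo.symm F₀ = 1 := mul_eq_left.1 (congrArg Prod.snd hcoord)
  rw [← phi₀Diffeo.apply_symm_apply F₀, hu]
  exact phi₀_one

theorem isProperAction_of_compactSpace (G X : Type*) [TopologicalSpace G] [TopologicalSpace X]
    [CompactSpace G] [T2Space X] [SMul G X] [ContinuousSMul G X] : IsProperAction G X := by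
  intro K hK
  have hc : IsCompact {p : G × X | p.2 ∈ K ∧ p.1 • p.2 ∈ K} :=
    (isCompact_univ.prod hK).of_isClosed_subset
      ((hK.isClosed.preimage continuous_snd).inter (hK.isClosed.preimage continuous_smul))
      fun _ hp => ⟨trivial, hp.1⟩
  convert hc.image continuous_fst using 1
  ext g
  simp [Set.Nonempty]

theorem isProperAction_regMobius : IsProperAction RegMobius₀ RegMobius := by
  have : CompactSpace RegMobius₀ := phi₀Homeo.compactSpace
  have : ContinuousSMul RegMobius₀ RegMobius := ⟨contMDiff_smul_regMobius.continuous⟩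
  exact isProperAction_of_compactSpace _ _

end SliceMobius

end

theorem mainTheorem8 :
    IsEmbeddedSubmanifoldMap modelSp11 𝓘(ℝ, Fin 2 → Fin 2 → ℍ[ℝ])
        (fun (A : Sp11) (i j : Fin 2) => A.1 i j) ∧
    IsSmoothSubmersion modelSp11 modelRegMobius toRegMobius ∧
    IsEmbeddedSubmanifoldMap (𝓡 3) modelRegMobius (Subtype.val : RegMobius₀ → RegMobius) ∧
    LieGroup (𝓡 3) ∞ RegMobius₀ ∧
    (∀ F₀ G₀ : RegMobius₀, (F₀ * G₀).1.toFun = F₀.1.toFun ∘ G₀.1.toFun) ∧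
    (∀ (F₀ : RegMobius₀) (F : RegMobius), (F₀ • F).toFun = F₀.1.toFun ∘ F.toFun) ∧
    ContMDiff ((𝓡 3).prod modelRegMobius) modelRegMobius ∞
      (fun p : RegMobius₀ × RegMobius => p.1 • p.2) ∧
    IsFreeAction RegMobius₀ RegMobius ∧
    IsProperAction RegMobius₀ RegMobius := by
  exact ⟨isEmbeddedSubmanifoldMap_sp11, isSmoothSubmersion_toRegMobius,
    isEmbeddedSubmanifoldMap_regMobius₀, lieGroup_regMobius₀, fun _ _ => rfl, fun _ _ => rfl,
    contMDiff_smul_regMobius, isFreeAction_regMobius, isProperAction_regMobius⟩
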